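/- Let $H$ be a complex Hilbert space of finite dimension $n$, with scalar product $\langle\cdot,\cdot\rangle$ linear in the first variable, and let $B(H)$ be the space of linear operators on $H$, regarded as a real normed space. For $u,v\in H$ let $uv^*$ be the operator $x\mapsto\langle x,v\rangle u$ and put $[u,v]=\frac12(uv^*+vu^*)$. For integers $p,q\ge 0$ let $\mathring{S}^{p,q}\subset B(H)$ be the set of self-adjoint operators of rank $p+q$ with exactly $p$ strictly positive and exactly $q$ strictly negative eigenvalues, counted with multiplicity. (1) $\mathring{S}^{1,0}$ is a real analytic manifold, analytically embedded in $B(H)$, of real dimension $2n-1$. Every $X\in\mathring{S}^{1,0}$ has the form $X=x_0x_0^*$ with $x_0\in H$, and for every such $x_0$ the tangent space (as a real subspace of $B(H)$) is $$T_X\mathring{S}^{1,0}=\{[x_0,y] : y\in H\}.$$ The $\mathbb{R}$-linear map $\varphi_{x_0}:y\mapsto[x_0,y]$ of $H$ onto $T_X\mathring{S}^{1,0}$ has kernel $\{iax_0 : a\in\mathbb{R}\}$. (2) $\mathring{S}^{1,1}$ is a real analytic manifold, analytically embedded in $B(H)$, of real dimension $4n-4$. Every $X\in\mathring{S}^{1,1}$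 has the form $X=[x_0,y_0]$ with $x_0,y_0\in H$, and for all such $x_0,y_0$ the tangent space is $$T_X\mathring{S}^{1,1}=\{[x_0,u]+[y_0,v] : u,v\in H\}.$$ The $\mathbb{R}$-linear map $\varphi_{x_0,y_0}:(u,v)\mapsto[x_0,u]+[y_0,v]$ of $H\times H$ onto $T_X\mathring{S}^{1,1}$ has kernel $$\{a(ix_0,0)+b(0,iy_0)+c(y_0,-x_0)+d(iy_0,ix_0) : a,b,c,d\in\mathbb{R}\}.$$ (If $n=0$, or in (2) if $n\le 1$, the set in question is empty and the claim about it is void.) -/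

import Mathlib

open scoped Manifold ContDiff

noncomputable section

section Operators

variable {H : Type*} [NormedAddCommGroup H] [InnerProductSpace ℂ H]

/-- The symmetric outer product `½ (u v* + v u*)`, where `(u v*)(x) = ⟨x, v⟩ u`, the scalar product
being linear in `x`. -/
def symOuter (u v : H) : H →L[ℂ] H :=
  (1 / 2 : ℝ) • (InnerProductSpace.rankOne ℂ u v + InnerProductSpace.rankOne ℂ v u)

theorem symOuter_add_right (u v w : H) : symOuter u (v + w) = symOuter u v + symOuter u w := by
  simp only [symOuter, map_add, add_apply, ← smul_add]
  congr 1
  abel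

theorem symOuter_smul_right (a : ℝ) (u v : H) : symOuter u (a • v) = a • symOuter u v := by
  ext x
  simp only [symOuter, smul_apply, add_apply, InnerProductSpace.rankOne_apply,
    ← Complex.coe_smul a v, inner_smul_left, Complex.conj_ofReal]
  simp only [← Complex.coe_smul, smul_add, smul_smul]
  congr 2 <;> ring_nf

/-- The `ℝ`-linear map `y ↦ ½ (x₀ y* + y x₀*)`. -/
def phiOne (x₀ : H) : H →ₗ[ℝ] (H →L[ℂ] H) where
  toFun y := symOuter x₀ y
  map_add' := symOuter_add_right x₀
  map_smul' a := symOuter_smul_right a x₀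

/-- The `ℝ`-linear map `(u, v) ↦ ½ (x₀ u* + u x₀*) + ½ (y₀ v* + v y₀*)`. -/
def phiTwo (x₀ y₀ : H) : H × H →ₗ[ℝ] (H →L[ℂ] H) where
  toFun w := symOuter x₀ w.1 + symOuter y₀ w.2
  map_add' w z := by
    simp only [Prod.fst_add, Prod.snd_add, symOuter_add_right]
    abel
  map_smul' a w := by
    simp only [Prod.smul_fst, Prod.smul_snd, symOuter_smul_right, smul_add, RingHom.id_apply]

variable (H) in
/-- The self-adjoint operators with at most `p` positive and at most `q` negative eigenvalues, counted
with multiplicity. -/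
def signatureAtMost [FiniteDimensional ℂ H] (p q : ℕ) : Set (H →L[ℂ] H) :=
  {T | ∃ hT : (T : H →ₗ[ℂ] H).IsSymmetric,
    Nat.card {i // 0 < hT.eigenvalues rfl i} ≤ p ∧ Nat.card {i // hT.eigenvalues rfl i < 0} ≤ q}

variable (H) in
/-- The operators in `signatureAtMost H p q` of rank `p + q`, that is, the self-adjoint operators with
exactly `p` positive and exactly `q` negative eigenvalues, counted with multiplicity. -/
def signatureExact [FiniteDimensional ℂ H] (p q : ℕ) : Set (H →L[ℂ] H) :=
  {T | T ∈ signatureAtMost H p q ∧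
    Module.finrank ℂ (LinearMap.range (T : H →ₗ[ℂ] H)) = p + q}

end Operators

section Submanifolds

variable {E : Type*} [NormedAddCommGroup E] [NormedSpace ℝ E]

/-- With the given charts (for the subspace topology), the subset `S` of the real normed space `E` is a
real analytic manifold of dimension `d`, analytically embedded in `E` by the inclusion. -/
structure IsAnalyticSubmanifold (d : ℕ) (S : Set E)
    [ChartedSpace (EuclideanSpace ℝ (Fin d)) S] : Prop where
  isManifold : IsManifold 𝓘(ℝ, EuclideanSpace ℝ (Fin d)) ω S
  isEmbedding : Manifold.IsSmoothEmbedding 𝓘(ℝ, EuclideanSpace ℝ (Fin d)) 𝓘(ℝ, E) ω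
    (Subtype.val : S → E)

/-- The tangent space of `S ⊆ E` at `X`, as a real subspace of `E`: the image of the intrinsic tangent
space under the differential of the inclusion. -/
def tangentSpaceIn (d : ℕ) (S : Set E) [ChartedSpace (EuclideanSpace ℝ (Fin d)) S] (X : S) :
    Submodule ℝ E :=
  LinearMap.range
    (mfderiv 𝓘(ℝ, EuclideanSpace ℝ (Fin d)) 𝓘(ℝ, E) (Subtype.val : S → E) X).toLinearMap

end Submanifolds

end

/-!
A self-adjoint operator lies in `signatureExact H 1 0` exactly when it has rank `1` and its quadratic
form takes a positive value; it lies in `signatureExact H 1 1` exactly when it has rank `2` and its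
quadratic form takes both signs. The sign conditions are open, so both sets are open pieces of the set
of self-adjoint operators of fixed rank, and only the rank condition has to be straightened.

Let `P` be the orthogonal projection onto the range of such an operator `X`, and `Q = 1 - P`. Near `X`
the corner `P T P` of the block decomposition of `T` is invertible on the range of `P`, and Gaussian
elimination (`exists_units_mul_schur`) shows that `T` has the rank of `X` iff the Schur complement of
this corner vanishes. Subtracting the term `Q T P (P T P + Q)⁻¹ P T Q` from `T` replaces the last block
by the Schur complement and keeps the others; so this is an analytic change of coordinates, inverted by
adding the same term, which carries the set to the subspace `{Z | Z = Z*, Q Z Q = 0}`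
(`exists_schurChart_straightening`). The term has order two at `X`, so the differential at `X` is the
identity and this subspace is the tangent space. `exists_isAnalyticSubmanifold` assembles such
coordinates into an embedded analytic submanifold.

The subspace consists of the operators `X J + J* X` (`mem_selfAdjointZeroBlock_rangeProj_iff`), which for
`X = [x₀, y₀]` are `[x₀, J* y₀] + [y₀, J* x₀]`. It is therefore the range of `phiOne` or `phiTwo`, and its
dimension follows from the kernels, computed by evaluating at vectors dual to `x₀` and `y₀`.
-/

noncomputable section

/-! ### Submanifolds from slice charts -/

section SliceCharts

variable {E V F : Type*} [NormedAddCommGroup E] [NormedSpace ℝ E]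
  [NormedAddCommGroup V] [NormedSpace ℝ V] [NormedAddCommGroup F] [NormedSpace ℝ F]

/-- A real analytic chart `toChart` of `E` in which, after the splitting `split : E ≃ V × F`, the
subset `S` becomes the slice `V × {0}`. -/
structure SliceChart (S : Set E) (V F : Type*) [NormedAddCommGroup V] [NormedSpace ℝ V]
    [NormedAddCommGroup F] [NormedSpace ℝ F] where
  /-- the analytic chart of the ambient space -/
  toChart : OpenPartialHomeomorph E E
  /-- the splitting of the model space into the direction of the slice and a complement -/
  split : E ≃L[ℝ] V × F
  contDiffOn_toChart : ContDiffOn ℝ ω toChart toChart.source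
  contDiffOn_symm : ContDiffOn ℝ ω toChart.symm toChart.target
  mem_iff : ∀ x ∈ toChart.source, x ∈ S ↔ (split (toChart x)).2 = 0

namespace SliceChart

variable {S : Set E}

/-- The inverse of the chart of `S` defined by a slice chart, as a map into the ambient space. -/
def param (c : SliceChart S V F) (v : V) : E := c.toChart.symm (c.split.symm (v, 0))

lemma param_mem (c : SliceChart S V F) {v : V} (hv : c.split.symm (v, 0) ∈ c.toChart.target) :
    c.param v ∈ S :=
  (c.mem_iff _ (c.toChart.map_target hv)).2 (by
    rw [c.toChart.right_inv hv]; simp)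

lemma isOpen_paramDomain (c : SliceChart S V F) :
    IsOpen {v : V | c.split.symm (v, 0) ∈ c.toChart.target} :=
  c.toChart.open_target.preimage (c.split.symm.continuous.comp (by fun_prop))

lemma contDiffOn_param (c : SliceChart S V F) :
    ContDiffOn ℝ ω c.param {v : V | c.split.symm (v, 0) ∈ c.toChart.target} :=
  c.contDiffOn_symm.comp
    (c.split.symm.contDiff.comp (contDiff_id.prodMk contDiff_const)).contDiffOn (fun _ hv => hv)

open Classical in
/-- The chart of the subset `S` defined by a slice chart. The base point only serves to give the
inverse a value off its domain. -/
def chart (c : SliceChart S V F) (X : S) : OpenPartialHomeomorph S V where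
  toFun x := (c.split (c.toChart x)).1
  invFun v := if hv : c.split.symm (v, 0) ∈ c.toChart.target then ⟨c.param v, c.param_mem hv⟩ else X
  source := {x | (x : E) ∈ c.toChart.source}
  target := {v | c.split.symm (v, 0) ∈ c.toChart.target}
  map_source' x hx := by
    have h0 := (c.mem_iff x hx).1 x.2
    have : (((c.split (c.toChart x)).1, 0) : V × F) = c.split (c.toChart x) := by
      rw [← h0]
    simpa [this] using c.toChart.map_source hx
  map_target' v hv := by
    have hv' : c.split.symm (v, 0) ∈ c.toChart.target := hv
    simp only [dif_pos hv', Set.mem_ofPred_eq]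
    exact c.toChart.map_target hv'
  left_inv' x hx := by
    have h0 := (c.mem_iff x hx).1 x.2
    have : (((c.split (c.toChart x)).1, 0) : V × F) = c.split (c.toChart x) := by
      rw [← h0]
    have h1 : c.split.symm ((c.split (c.toChart x)).1, 0) ∈ c.toChart.target := by
      simpa [this] using c.toChart.map_source hx
    simp only [dif_pos h1]
    apply Subtype.ext
    simpa [param, this] using c.toChart.left_inv hx
  right_inv' v hv := by
    have hv' : c.split.symm (v, 0) ∈ c.toChart.target := hv
    simp only [dif_pos hv', param]
    rw [c.toChart.right_inv hv']; simp
  open_source := c.toChart.open_source.preimage continuous_subtype_val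
  open_target := c.isOpen_paramDomain
  continuousOn_toFun := by
    have h := c.toChart.continuousOn.comp (continuous_subtype_val (p := (· ∈ S))).continuousOn
      (s := {x : S | (x : E) ∈ c.toChart.source}) (fun x hx => hx)
    exact continuous_fst.comp_continuousOn (c.split.continuous.comp_continuousOn h)
  continuousOn_invFun := by
    rw [Topology.IsInducing.subtypeVal.continuousOn_iff]
    refine c.contDiffOn_param.continuousOn.congr fun v hv => ?_
    have hv' : c.split.symm (v, 0) ∈ c.toChart.target := hv
    simp [dif_pos hv']

lemma chart_apply (c : SliceChart S V F) (X x : S) :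
    c.chart X x = (c.split (c.toChart x)).1 := rfl

lemma mem_chart_source (c : SliceChart S V F) (X x : S) :
    x ∈ (c.chart X).source ↔ (x : E) ∈ c.toChart.source := Iff.rfl

open Classical in
lemma coe_chart_symm (c : SliceChart S V F) (X : S) {v : V} (hv : v ∈ (c.chart X).target) :
    ((c.chart X).symm v : E) = c.param v := by
  have hv' : c.split.symm (v, 0) ∈ c.toChart.target := hv
  change ((if hv : c.split.symm (v, 0) ∈ c.toChart.target then
    (⟨c.param v, c.param_mem hv⟩ : S) else X : S) : E) = _
  rw [dif_pos hv']

/-- The charted space structure on `S` given by a slice chart at each of its points. -/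
@[reducible] def chartedSpace (c : ∀ _ : S, SliceChart S V F)
    (hc : ∀ X : S, (X : E) ∈ (c X).toChart.source) :
    ChartedSpace V S where
  atlas := Set.range fun X => (c X).chart X
  chartAt X := (c X).chart X
  mem_chart_source X := hc X
  chart_mem_atlas X := ⟨X, rfl⟩

lemma isManifold (c : ∀ _ : S, SliceChart S V F) (hc : ∀ X : S, (X : E) ∈ (c X).toChart.source) :
    letI := chartedSpace c hc
    IsManifold 𝓘(ℝ, V) ω S := by
  let := chartedSpace c hc
  refine isManifold_of_contDiffOn _ _ _ ?_
  rintro _ _ ⟨X, rfl⟩ ⟨Y, rfl⟩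
  have key : ContDiffOn ℝ ω (fun v => ((c Y).split ((c Y).toChart ((c X).param v))).1)
      (((c X).chart X).symm ≫ₕ (c Y).chart Y).source := by
    refine contDiff_fst.comp_contDiffOn ((c Y).split.contDiff.comp_contDiffOn
      ((c Y).contDiffOn_toChart.comp ((c X).contDiffOn_param.mono ?_) ?_))
    · intro v hv
      rw [OpenPartialHomeomorph.trans_source] at hv
      exact hv.1
    · intro v hv
      rw [OpenPartialHomeomorph.trans_source] at hv
      have h2 := hv.2
      rw [Set.mem_preimage, mem_chart_source, coe_chart_symm _ _ hv.1] at h2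
      exact h2
  simp only [modelWithCornersSelf_coe, modelWithCornersSelf_coe_symm, Set.preimage_id,
    Set.range_id, Set.inter_univ, Function.id_comp, Function.comp_id]
  refine key.congr fun v hv => ?_
  rw [OpenPartialHomeomorph.trans_source] at hv
  rw [OpenPartialHomeomorph.coe_trans, Function.comp_apply, chart_apply, coe_chart_symm _ _ hv.1]

lemma isSmoothEmbedding_val (c : ∀ _ : S, SliceChart S V F)
    (hc : ∀ X : S, (X : E) ∈ (c X).toChart.source) :
    letI := chartedSpace c hc
    Manifold.IsSmoothEmbedding 𝓘(ℝ, V) 𝓘(ℝ, E) ω (Subtype.val : S → E) := by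
  let := chartedSpace c hc
  have := isManifold c hc
  refine ⟨Manifold.IsImmersionOfComplement.isImmersion (F := F) fun X => ?_, .subtypeVal⟩
  refine Manifold.IsImmersionAtOfComplement.mk_of_charts (c X).split.symm ((c X).chart X)
    (c X).toChart (hc X) (hc X)
    (IsManifold.subset_maximalAtlas ⟨X, rfl⟩) ?_ (fun x hx => hx) ?_
  · refine StructureGroupoid.mem_maximalAtlas_of_mem_groupoid _ ?_
    rw [contDiffGroupoid, mem_groupoid_of_pregroupoid]
    simpa [contDiffPregroupoid] using ⟨(c X).contDiffOn_toChart, (c X).contDiffOn_symm⟩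
  · intro v hv
    have hv' : v ∈ ((c X).chart X).target := by simpa using hv
    have := coe_chart_symm (c X) X hv'
    simp only [OpenPartialHomeomorph.extend, mfld_simps, Function.comp_apply] at hv ⊢
    rw [this]
    exact (c X).toChart.right_inv hv'

/-- In the chart at `X`, the inclusion is the parametrization `param`, which gives its differential. -/
lemma mfderiv_val (c : ∀ _ : S, SliceChart S V F)
    (hc : ∀ X : S, (X : E) ∈ (c X).toChart.source) (X : S) {D : E →L[ℝ] E}
    (hD : HasFDerivAt (c X).toChart.symm D ((c X).toChart X)) :
    letI := chartedSpace c hc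
    mfderiv 𝓘(ℝ, V) 𝓘(ℝ, E) (Subtype.val : S → E) X =
      D ∘L ((c X).split.symm : V × F →L[ℝ] E) ∘L ContinuousLinearMap.inl ℝ V F := by
  let := chartedSpace c hc
  have := isManifold c hc
  have hd : MDifferentiableAt 𝓘(ℝ, V) 𝓘(ℝ, E) (Subtype.val : S → E) X :=
    (isSmoothEmbedding_val c hc).contMDiff.mdifferentiableAt (by simp)
  have hX : ((c X).split.symm (((c X).chart X X), 0)) = (c X).toChart X := by
    have h0 := ((c X).mem_iff X (hc X)).1 X.2
    rw [chart_apply, ← h0]; simp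
  have hp : HasFDerivAt (c X).param
      (D ∘L ((c X).split.symm : V × F →L[ℝ] E) ∘L ContinuousLinearMap.inl ℝ V F)
      ((c X).chart X X) := by
    rw [← hX] at hD
    exact HasFDerivAt.comp (f := fun v => (c X).split.symm (v, 0)) _ hD
      (((c X).split.symm : V × F →L[ℝ] E) ∘L ContinuousLinearMap.inl ℝ V F).hasFDerivAt
  refine HasMFDerivAt.mfderiv ⟨continuous_subtype_val.continuousAt, ?_⟩
  have : HasFDerivAt (writtenInExtChartAt 𝓘(ℝ, V) 𝓘(ℝ, E) X (Subtype.val : S → E))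
      (D ∘L ((c X).split.symm : V × F →L[ℝ] E) ∘L ContinuousLinearMap.inl ℝ V F)
      ((c X).chart X X) := by
    refine hp.congr_of_eventuallyEq ?_
    have hmem : ((c X).chart X X) ∈ ((c X).chart X).target := ((c X).chart X).map_source (hc X)
    filter_upwards [((c X).chart X).open_target.mem_nhds hmem] with v hv
    exact coe_chart_symm (c X) X hv
  exact this.hasFDerivWithinAt

end SliceChart

/-- A linear splitting of a finite-dimensional space along a subspace, with standard models for the
subspace and its complement. -/
lemma exists_split [FiniteDimensional ℝ E] {d : ℕ} (W : Submodule ℝ E)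
    (hd : Module.finrank ℝ W = d) :
    ∃ L : E ≃L[ℝ] EuclideanSpace ℝ (Fin d) × EuclideanSpace ℝ (Fin (Module.finrank ℝ E - d)),
      ∀ x, x ∈ W ↔ (L x).2 = 0 := by
  obtain ⟨W', hW⟩ := W.exists_isCompl
  have h := Submodule.finrank_add_eq_of_isCompl hW
  let e₁ : W ≃ₗ[ℝ] EuclideanSpace ℝ (Fin d) := LinearEquiv.ofFinrankEq _ _ (by simp [hd])
  let e₂ : W' ≃ₗ[ℝ] EuclideanSpace ℝ (Fin (Module.finrank ℝ E - d)) :=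
    LinearEquiv.ofFinrankEq _ _ (by simp; omega)
  let e := ((Submodule.prodEquivOfIsCompl W W' hW).symm.trans (e₁.prodCongr e₂))
  refine ⟨e.toContinuousLinearEquiv, fun x => ?_⟩
  change _ ↔ e₂ ((Submodule.prodEquivOfIsCompl W W' hW).symm x).2 = 0
  rw [map_eq_zero_iff e₂ e₂.injective]
  exact (Submodule.prodEquivOfIsCompl_symm_apply_snd_eq_zero _ W' hW).symm

/-- A subset of a finite-dimensional space is an embedded analytic submanifold as soon as, near each
of its points `X`, an analytic change of coordinates whose inverse has differential `1` at the image
of `X` turns it into a subspace `W X` of dimension `d`; the tangent space at `X` is then `W X`. -/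
theorem exists_isAnalyticSubmanifold [FiniteDimensional ℝ E] {d : ℕ} {S : Set E}
    (W : E → Submodule ℝ E) (hd : ∀ X ∈ S, Module.finrank ℝ (W X) = d)
    (h : ∀ X ∈ S, ∃ Ψ : OpenPartialHomeomorph E E, X ∈ Ψ.source ∧ ContDiffOn ℝ ω Ψ Ψ.source ∧
      ContDiffOn ℝ ω Ψ.symm Ψ.target ∧ (∀ x ∈ Ψ.source, x ∈ S ↔ Ψ x ∈ W X) ∧
      HasFDerivAt Ψ.symm (ContinuousLinearMap.id ℝ E) (Ψ X)) :
    ∃ _ : ChartedSpace (EuclideanSpace ℝ (Fin d)) S, IsAnalyticSubmanifold d S ∧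
      ∀ X : S, tangentSpaceIn d S X = W X := by
  choose Ψ hsrc hΨ hΨ' hmem hder using h
  choose L hL using fun X hX => exists_split (W X) (hd X hX)
  let c : ∀ _ : S, SliceChart S (EuclideanSpace ℝ (Fin d))
      (EuclideanSpace ℝ (Fin (Module.finrank ℝ E - d))) := fun X =>
    { toChart := Ψ X X.2
      split := L X X.2
      contDiffOn_toChart := hΨ X X.2
      contDiffOn_symm := hΨ' X X.2
      mem_iff := fun x hx => (hmem X X.2 x hx).trans (hL X X.2 _) }
  have hc : ∀ X : S, (X : E) ∈ (c X).toChart.source := fun X => hsrc X X.2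
  let := SliceChart.chartedSpace c hc
  refine ⟨this, ⟨SliceChart.isManifold c hc, SliceChart.isSmoothEmbedding_val c hc⟩, fun X => ?_⟩
  have hm := SliceChart.mfderiv_val c hc X (hder X X.2)
  ext T
  rw [tangentSpaceIn, hm]
  change (∃ v, (L X X.2).symm (v, 0) = T) ↔ _
  rw [hL X X.2]
  constructor
  · rintro ⟨v, rfl⟩; simp
  · intro hT
    exact ⟨(L X X.2 T).1, by rw [← hT]; simp⟩

end SliceCharts

/-! ### Schur complements and operators of fixed rank -/

section SchurComplement

variable {A : Type*} [Ring A]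

/-- For an idempotent `p` with complement `q = 1 - p`, the element `q T p (p T p + q)⁻¹ p T q`. If
`T` is a block matrix `(a, b; c, d)` with invertible corner `a`, this is `c a⁻¹ b` placed in the last
block, so that subtracting it from `T` replaces `d` by the Schur complement of `a`. -/
def schurCorrection (p T : A) : A :=
  ((1 - p) * T * p) * (Ring.inverse (p * T * p + (1 - p)) * (p * T * (1 - p)))

lemma mul_schurCorrection {p : A} (hp : p * p = p) (T : A) : p * schurCorrection p T = 0 := by
  have h : p * (1 - p) = 0 := by rw [mul_sub, hp, mul_one, sub_self]
  simp only [schurCorrection, ← mul_assoc, h, zero_mul]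

lemma schurCorrection_mul {p : A} (hp : p * p = p) (T : A) : schurCorrection p T * p = 0 := by
  have h : (1 - p) * p = 0 := by rw [sub_mul, hp, one_mul, sub_self]
  simp only [schurCorrection, mul_assoc, h, mul_zero]

/-- The correction term only depends on the blocks of `T` other than the last one. -/
lemma schurCorrection_add {p : A} (T Z : A) (h₁ : p * Z = 0) (h₂ : Z * p = 0) :
    schurCorrection p (T + Z) = schurCorrection p T := by
  have e₁ : p * (T + Z) = p * T := by rw [mul_add, h₁, add_zero]
  have e₂ : (1 - p) * (T + Z) * p = (1 - p) * T * p := by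
    rw [mul_assoc, add_mul, h₂, add_zero, mul_assoc]
  rw [schurCorrection, e₁, e₂, schurCorrection]

/-- Block Gaussian elimination: up to invertible factors on both sides, `T` is the block diagonal
element with entries `1` and the Schur complement. -/
lemma exists_units_mul_schur {p : A} (hp : p * p = p) (T : A)
    (hT : IsUnit (p * T * p + (1 - p))) :
    ∃ u v : Aˣ, T = u * (p + (1 - p) * (T - schurCorrection p T) * (1 - p)) * v := by
  set q := 1 - p with hq
  have hqq : q * q = q := by simp [hq, mul_sub, sub_mul, hp]
  have hpq : p * q = 0 := by simp [hq, mul_sub, hp]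
  have hqp : q * p = 0 := by simp [hq, sub_mul, hp]
  have hsum : p + q = 1 := by simp [hq]
  set M := p * T * p + q with hM
  set N := Ring.inverse M with hN
  have hMN : M * N = 1 := Ring.mul_inverse_cancel _ hT
  have hNM : N * M = 1 := Ring.inverse_mul_cancel _ hT
  have hMp : M * p = p * T * p := by rw [hM, add_mul, mul_assoc, hp, hqp, add_zero]
  have hpM : p * M = p * T * p := by
    rw [hM, mul_add, ← mul_assoc, ← mul_assoc, hp, hpq, add_zero]
  have hNp : N * p = p * N := by
    calc N * p = N * (p * M) * N := by rw [mul_assoc, mul_assoc, hMN, mul_one]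
      _ = p * N := by rw [hpM, ← hMp, ← mul_assoc, hNM, one_mul]
  have hNq : N * q = q * N := by rw [hq, mul_sub, sub_mul, hNp, mul_one, one_mul]
  set b := p * T * q with hb
  set c := q * T * p with hc
  have hcorr : schurCorrection p T = c * (N * b) := rfl
  clear_value b c N M q
  have hpb : p * b = b := by rw [hb, ← mul_assoc, ← mul_assoc, hp]
  have hqb : q * b = 0 := by rw [hb, ← mul_assoc, ← mul_assoc, hqp, zero_mul, zero_mul]
  have hbp : b * p = 0 := by rw [hb, mul_assoc, hqp, mul_zero]
  have hcp : c * p = c := by rw [hc, mul_assoc, hp]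
  have hcq : c * q = 0 := by rw [hc, mul_assoc, hpq, mul_zero]
  have hqc : q * c = c := by rw [hc, ← mul_assoc, ← mul_assoc, hqq]
  have hbb : N * b * (N * b) = 0 := by
    calc N * b * (N * b) = N * (b * (N * (p * b))) := by rw [hpb, mul_assoc]
      _ = N * ((b * p) * (N * b)) := by rw [← mul_assoc N p, hNp, mul_assoc p, mul_assoc b p]
      _ = 0 := by rw [hbp, zero_mul, mul_zero]
  have hcc : c * N * (c * N) = 0 := by
    calc c * N * (c * N) = c * (N * (q * c) * N) := by rw [hqc, mul_assoc, mul_assoc]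
      _ = (c * q) * (N * (c * N)) := by
        rw [← mul_assoc N q, hNq]; simp only [mul_assoc]
      _ = 0 := by rw [hcq, zero_mul]
  -- `c N` and `N b` are off-diagonal and square to zero, whence the elementary factors.
  let u₁ : Aˣ := ⟨1 + c * N, 1 - c * N, by noncomm_ring [hcc], by noncomm_ring [hcc]⟩
  let v : Aˣ := ⟨1 + N * b, 1 - N * b, by noncomm_ring [hbb], by noncomm_ring [hbb]⟩
  let m : Aˣ := ⟨M, N, hMN, hNM⟩
  refine ⟨u₁ * m, v, ?_⟩
  set s := q * (T - schurCorrection p T) * q with hs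
  have hqs : q * s = s := by rw [hs, ← mul_assoc, ← mul_assoc, hqq]
  have hsq : s * q = s := by rw [hs, mul_assoc, hqq]
  have hps : p * s = 0 := by rw [hs, ← mul_assoc, ← mul_assoc, hpq, zero_mul, zero_mul]
  have hcs : c * s = 0 := by rw [← hqs, ← mul_assoc, hcq, zero_mul]
  have hMs : M * s = s := by
    rw [hM, add_mul, mul_assoc _ p, hps, mul_zero, zero_add, hqs]
  have hs' : s = q * T * q - c * (N * b) := by
    have hbq : b * q = b := by rw [hb, mul_assoc, hqq]
    rw [hs, hcorr, mul_sub, sub_mul, ← mul_assoc q c, hqc, mul_assoc c, mul_assoc N, hbq]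
  have hsNb : s * (N * b) = 0 := by
    rw [← hsq, mul_assoc, ← mul_assoc q, ← hNq, mul_assoc N, hqb, mul_zero, mul_zero]
  have hpNb : M * p * (N * b) = b := by
    rw [mul_assoc, ← mul_assoc p, ← hNp, mul_assoc N, hpb, ← mul_assoc, hMN, one_mul]
  have hleft : (1 + c * N) * M * (p + s) = M * p + c + s := by
    rw [add_mul, one_mul, mul_assoc c, hNM, mul_one, add_mul, mul_add, mul_add, hMs, hcp, hcs,
      add_zero]
    abel
  change T = (1 + c * N) * M * (p + s) * (1 + N * b)
  rw [hleft, mul_add, mul_one, add_mul, add_mul, hpNb, hsNb, add_zero, hMp, hs']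
  calc T = (p + q) * T * (p + q) := by rw [hsum, one_mul, mul_one]
    _ = _ := by rw [hb, hc, add_mul, mul_add, add_mul, add_mul]; abel

lemma star_schurCorrection [StarRing A] {p T : A} (hp : star p = p) (hT : star T = T) :
    star (schurCorrection p T) = schurCorrection p T := by
  simp only [schurCorrection, star_mul, ← Ring.inverse_star, star_add, star_sub, star_one, hp, hT,
    mul_assoc]

end SchurComplement

section SchurChart

variable {A : Type*} [NormedRing A] [NormedAlgebra ℝ A] [CompleteSpace A]

lemma contDiffAt_schurCorrection (p : A) {T : A} (hT : IsUnit (p * T * p + (1 - p))) :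
    ContDiffAt ℝ ω (schurCorrection p) T := by
  have h₁ : ContDiffAt ℝ ω (fun T : A => (1 - p) * T * p) T := by fun_prop
  have h₂ : ContDiffAt ℝ ω (fun T : A => p * T * (1 - p)) T := by fun_prop
  have h₃ : ContDiffAt ℝ ω (fun T : A => p * T * p + (1 - p)) T := by fun_prop
  obtain ⟨u, hu⟩ := hT
  have h₄ : ContDiffAt ℝ ω Ring.inverse (p * T * p + (1 - p)) := by
    rw [← hu]; exact contDiffAt_ringInverse ℝ u
  exact h₁.mul ((ContDiffAt.comp (f := fun T : A => p * T * p + (1 - p)) T h₄ h₃).mul h₂)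

/-- The correction term vanishes to second order at an element that commutes with `p`. -/
lemma hasFDerivAt_schurCorrection {p X : A} (h₁ : (1 - p) * X * p = 0) (h₂ : p * X * (1 - p) = 0)
    (hX : IsUnit (p * X * p + (1 - p))) :
    HasFDerivAt (schurCorrection p) (0 : A →L[ℝ] A) X := by
  have d₁ : DifferentiableAt ℝ (fun T : A => (1 - p) * T * p) X := by fun_prop
  have d₂ : DifferentiableAt ℝ (fun T : A => p * T * (1 - p)) X := by fun_prop
  have d₃ : DifferentiableAt ℝ (fun T : A => p * T * p + (1 - p)) X := by fun_prop
  obtain ⟨u, hu⟩ := hX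
  have d₄ : DifferentiableAt ℝ Ring.inverse (p * X * p + (1 - p)) := by
    rw [← hu]; exact differentiableAt_inverse u.isUnit
  have d₅ : DifferentiableAt ℝ
      (fun T : A => Ring.inverse (p * T * p + (1 - p)) * (p * T * (1 - p))) X :=
    (d₄.comp X d₃).mul d₂
  have h := d₁.hasFDerivAt.mul' d₅.hasFDerivAt
  rw [h₁, h₂, mul_zero] at h
  have h0 : (0 : A) • fderiv ℝ (fun T : A =>
      Ring.inverse (p * T * p + (1 - p)) * (p * T * (1 - p))) X +
      MulOpposite.op (0 : A) • fderiv ℝ (fun T : A => (1 - p) * T * p) X = 0 := by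
    ext; simp
  rw [h0] at h
  exact h

/-- Subtracting the Schur correction, as an analytic change of coordinates of the algebra. -/
def schurChart (p : A) (hp : p * p = p) : OpenPartialHomeomorph A A where
  toFun T := T - schurCorrection p T
  invFun T := T + schurCorrection p T
  source := {T | IsUnit (p * T * p + (1 - p))}
  target := {T | IsUnit (p * T * p + (1 - p))}
  map_source' T hT := by
    have h : p * (T - schurCorrection p T) = p * T := by
      rw [mul_sub, mul_schurCorrection hp, sub_zero]
    simpa [h] using hT
  map_target' T hT := by
    have h : p * (T + schurCorrection p T) = p * T := by
      rw [mul_add, mul_schurCorrection hp, add_zero]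
    simpa [h] using hT
  left_inv' T _ := by
    rw [sub_eq_add_neg, schurCorrection_add T _ (by rw [mul_neg, mul_schurCorrection hp, neg_zero])
      (by rw [neg_mul, schurCorrection_mul hp, neg_zero])]
    abel
  right_inv' T _ := by
    rw [schurCorrection_add T _ (mul_schurCorrection hp T) (schurCorrection_mul hp T)]
    abel
  open_source := Units.isOpen.preimage (by fun_prop)
  open_target := Units.isOpen.preimage (by fun_prop)
  continuousOn_toFun T hT :=
    (continuousAt_id.sub (contDiffAt_schurCorrection p hT).continuousAt).continuousWithinAt
  continuousOn_invFun T hT :=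
    (continuousAt_id.add (contDiffAt_schurCorrection p hT).continuousAt).continuousWithinAt

lemma contDiffOn_schurChart (p : A) (hp : p * p = p) :
    ContDiffOn ℝ ω (schurChart p hp) (schurChart p hp).source := fun _ hT =>
  (contDiffAt_id.sub (contDiffAt_schurCorrection p hT)).contDiffWithinAt

lemma contDiffOn_schurChart_symm (p : A) (hp : p * p = p) :
    ContDiffOn ℝ ω (schurChart p hp).symm (schurChart p hp).target := fun _ hT =>
  (contDiffAt_id.add (contDiffAt_schurCorrection p hT)).contDiffWithinAt

end SchurChart

section FixedRank

variable {H : Type*} [NormedAddCommGroup H] [InnerProductSpace ℂ H] [FiniteDimensional ℂ H]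

lemma finrank_range_units_mul_mul (u v : (H →L[ℂ] H)ˣ) (T : H →L[ℂ] H) :
    Module.finrank ℂ (LinearMap.range ((u * T * v : H →L[ℂ] H) : H →ₗ[ℂ] H)) =
      Module.finrank ℂ (LinearMap.range (T : H →ₗ[ℂ] H)) := by
  have hv : LinearMap.range ((v : H →L[ℂ] H) : H →ₗ[ℂ] H) = ⊤ :=
    LinearMap.range_eq_top.2 (ContinuousLinearMap.isUnit_iff_bijective.1 v.isUnit).2
  have hu : Function.Injective ((u : H →L[ℂ] H) : H →ₗ[ℂ] H) :=
    (ContinuousLinearMap.isUnit_iff_bijective.1 u.isUnit).1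
  have h : ((u * T * v : H →L[ℂ] H) : H →ₗ[ℂ] H) =
    (((u : H →L[ℂ] H) : H →ₗ[ℂ] H) ∘ₗ (T : H →ₗ[ℂ] H)) ∘ₗ ((v : H →L[ℂ] H) : H →ₗ[ℂ] H) := rfl
  rw [h, LinearMap.range_comp_of_range_eq_top _ hv, LinearMap.range_comp]
  exact (Submodule.equivMapOfInjective _ hu _).finrank_eq.symm

/-- A block diagonal operator with an identity block has the rank of this block only if the other
block vanishes. -/
lemma finrank_range_add_eq_iff {P : H →L[ℂ] H} (hP : P * P = P) (Z : H →L[ℂ] H) :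
    Module.finrank ℂ (LinearMap.range ((P + (1 - P) * Z * (1 - P) : H →L[ℂ] H) : H →ₗ[ℂ] H)) =
      Module.finrank ℂ (LinearMap.range (P : H →ₗ[ℂ] H)) ↔ (1 - P) * Z * (1 - P) = 0 := by
  set S := (1 - P) * Z * (1 - P) with hS
  have hPS : P * S = 0 := by simp [hS, ← mul_assoc, mul_sub, hP]
  have hSP : S * P = 0 := by simp [hS, mul_assoc, sub_mul, hP]
  constructor
  -- The range of `P + S` contains that of `P`, since `(P + S) P = P`; equal ranks make them equal.
  · intro h
    have hle : LinearMap.range (P : H →ₗ[ℂ] H) ≤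
        LinearMap.range ((P + S : H →L[ℂ] H) : H →ₗ[ℂ] H) := by
      rintro _ ⟨x, rfl⟩
      refine ⟨P x, ?_⟩
      have := congrArg (· x) (show (P + S) * P = P by rw [add_mul, hP, hSP, add_zero])
      simpa using this
    have heq := Submodule.eq_of_le_of_finrank_eq hle h.symm
    ext x
    have hx : (P + S) x ∈ LinearMap.range (P : H →ₗ[ℂ] H) := heq ▸ ⟨x, rfl⟩
    obtain ⟨y, hy⟩ := hx
    have h₁ : P ((P + S) x) = (P + S) x := by
      rw [← hy]; exact congrArg (· y) hP
    have h₂ : P ((P + S) x) = P x := by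
      have := congrArg (· x) (show P * (P + S) = P by rw [mul_add, hP, hPS, add_zero])
      simpa using this
    have h₃ : P x + S x = P x := by
      have h₄ : (P + S) x = P x + S x := rfl
      rw [← h₄, ← h₁, h₂]
    simpa using h₃
  · intro h
    rw [h, add_zero]

/-- For an orthogonal projection `P`, the real space of self-adjoint operators whose compression to
the kernel of `P` vanishes. -/
def selfAdjointZeroBlock (P : H →L[ℂ] H) : Submodule ℝ (H →L[ℂ] H) where
  carrier := {Z | star Z = Z ∧ (1 - P) * Z * (1 - P) = 0}
  add_mem' := by
    rintro Z Z' ⟨h₁, h₂⟩ ⟨h₁', h₂'⟩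
    exact ⟨by rw [star_add, h₁, h₁'], by rw [mul_add, add_mul, h₂, h₂', add_zero]⟩
  zero_mem' := by simp
  smul_mem' := by
    rintro a Z ⟨h₁, h₂⟩
    exact ⟨by rw [star_smul, h₁, star_trivial], by rw [mul_smul_comm, smul_mul_assoc, h₂, smul_zero]⟩

lemma mem_selfAdjointZeroBlock {P Z : H →L[ℂ] H} :
    Z ∈ selfAdjointZeroBlock P ↔ star Z = Z ∧ (1 - P) * Z * (1 - P) = 0 := Iff.rfl

/-- The orthogonal projection onto the range of an operator. -/
def rangeProj (X : H →L[ℂ] H) : H →L[ℂ] H := (LinearMap.range (X : H →ₗ[ℂ] H)).starProjection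

lemma rangeProj_mul_self (X : H →L[ℂ] H) : rangeProj X * rangeProj X = rangeProj X :=
  (Submodule.isIdempotentElem_starProjection _)

lemma star_rangeProj (X : H →L[ℂ] H) : star (rangeProj X) = rangeProj X :=
  isSelfAdjoint_starProjection _

lemma rangeProj_mul (X : H →L[ℂ] H) : rangeProj X * X = X := by
  ext x
  exact Submodule.starProjection_eq_self_iff.2 ⟨x, rfl⟩

lemma mul_rangeProj {X : H →L[ℂ] H} (hX : star X = X) : X * rangeProj X = X := by
  have := congrArg star (rangeProj_mul X)
  rwa [star_mul, star_rangeProj, hX] at this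

lemma range_rangeProj (X : H →L[ℂ] H) :
    LinearMap.range (rangeProj X : H →ₗ[ℂ] H) = LinearMap.range (X : H →ₗ[ℂ] H) :=
  Submodule.range_starProjection _

/-- A self-adjoint operator is invertible on its range. -/
lemma isUnit_add_one_sub_rangeProj {X : H →L[ℂ] H} (hX : star X = X) :
    IsUnit (X + (1 - rangeProj X)) := by
  have hXP := mul_rangeProj hX
  have hPX := rangeProj_mul X
  have hPP := rangeProj_mul_self X
  rw [ContinuousLinearMap.isUnit_iff_bijective]
  have hinj : Function.Injective ⇑(X + (1 - rangeProj X)) := by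
    rw [injective_iff_map_eq_zero]
    intro v hv
    have h₁ : X v = 0 := by
      have e : rangeProj X * (X + (1 - rangeProj X)) = X := by
        rw [mul_add, hPX, mul_sub, hPP, mul_one, sub_self, add_zero]
      have h := congrArg (· v) e
      change rangeProj X ((X + (1 - rangeProj X)) v) = X v at h
      rw [← h, hv, map_zero]
    have h₂ : rangeProj X v = v := by
      have : X v + (v - rangeProj X v) = 0 := hv
      rw [h₁, zero_add, sub_eq_zero] at this
      exact this.symm
    obtain ⟨w, hw⟩ : v ∈ LinearMap.range (X : H →ₗ[ℂ] H) :=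
      Submodule.starProjection_eq_self_iff.1 h₂
    have hw' : X w = v := hw
    have hadj : ContinuousLinearMap.adjoint X = X := hX
    rw [← inner_self_eq_zero (𝕜 := ℂ)]
    nth_rewrite 2 [← hw']
    rw [← ContinuousLinearMap.adjoint_inner_left, hadj, h₁, inner_zero_left]
  exact ⟨hinj, (LinearMap.injective_iff_surjective
    (f := ((X + (1 - rangeProj X) : H →L[ℂ] H) : H →ₗ[ℂ] H))).1 hinj⟩

/-- The Schur chart straightens the self-adjoint operators of fixed rank near one of them, also after
an open condition is imposed. -/
lemma exists_schurChart_straightening {S O : Set (H →L[ℂ] H)} {r : ℕ} (hO : IsOpen O)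
    (hS : ∀ T, T ∈ S ↔ star T = T ∧
      Module.finrank ℂ (LinearMap.range (T : H →ₗ[ℂ] H)) = r ∧ T ∈ O)
    {X : H →L[ℂ] H} (hX : X ∈ S) :
    ∃ Ψ : OpenPartialHomeomorph (H →L[ℂ] H) (H →L[ℂ] H), X ∈ Ψ.source ∧
      ContDiffOn ℝ ω Ψ Ψ.source ∧ ContDiffOn ℝ ω Ψ.symm Ψ.target ∧
      (∀ T ∈ Ψ.source, T ∈ S ↔ Ψ T ∈ selfAdjointZeroBlock (rangeProj X)) ∧
      HasFDerivAt Ψ.symm (ContinuousLinearMap.id ℝ (H →L[ℂ] H)) (Ψ X) := by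
  obtain ⟨hsa, hr, hXO⟩ := (hS X).1 hX
  set P := rangeProj X with hPdef
  have hP : P * P = P := rangeProj_mul_self X
  have hPs : star P = P := star_rangeProj X
  have hPX : P * X = X := rangeProj_mul X
  have hXP : X * P = X := mul_rangeProj hsa
  have hunit : IsUnit (P * X * P + (1 - P)) := by
    rw [hPX, hXP]; exact isUnit_add_one_sub_rangeProj hsa
  have hb : P * X * (1 - P) = 0 := by rw [hPX, mul_sub, mul_one, hXP, sub_self]
  have hc : (1 - P) * X * P = 0 := by rw [sub_mul, one_mul, hPX, sub_self, zero_mul]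
  have hX0 : schurCorrection P X = 0 := by rw [schurCorrection, hc, zero_mul]
  have hΨ := contDiffOn_schurChart P hP
  have hΨ' := contDiffOn_schurChart_symm P hP
  refine ⟨(schurChart P hP).restrOpen O hO, ⟨hunit, hXO⟩, hΨ.mono fun T hT => hT.1,
    hΨ'.mono fun T hT => ?_, ?_, ?_⟩
  · rw [OpenPartialHomeomorph.restrOpen] at hT
    exact hT.1
  · rintro T ⟨hT, hTO⟩
    change T ∈ S ↔ T - schurCorrection P T ∈ _
    have hcorr : schurCorrection P (T - schurCorrection P T) = schurCorrection P T := by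
      rw [sub_eq_add_neg, schurCorrection_add T _ (by rw [mul_neg, mul_schurCorrection hP, neg_zero])
        (by rw [neg_mul, schurCorrection_mul hP, neg_zero])]
    have hstar : star T = T ↔ star (T - schurCorrection P T) = T - schurCorrection P T := by
      constructor <;> intro h
      · rw [star_sub, h, star_schurCorrection hPs h]
      · have h' := star_schurCorrection hPs h
        rw [hcorr] at h'
        rw [star_sub, h'] at h
        exact sub_left_injective h
    have hrank : Module.finrank ℂ (LinearMap.range (T : H →ₗ[ℂ] H)) = r ↔
        (1 - P) * (T - schurCorrection P T) * (1 - P) = 0 := by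
      obtain ⟨u, v, huv⟩ := exists_units_mul_schur hP T hT
      have e := finrank_range_units_mul_mul u v
        (P + (1 - P) * (T - schurCorrection P T) * (1 - P))
      rw [← huv] at e
      rw [← finrank_range_add_eq_iff hP, ← e, hPdef, range_rangeProj, hr]
    rw [hS, hrank, mem_selfAdjointZeroBlock, hstar]
    exact ⟨fun h => ⟨h.1, h.2.1⟩, fun h => ⟨h.1, h.2, hTO⟩⟩
  · change HasFDerivAt (fun T => T + schurCorrection P T) _ (X - schurCorrection P X)
    rw [hX0, sub_zero]
    have h := (hasFDerivAt_id X).add (hasFDerivAt_schurCorrection hc hb hunit)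
    rw [add_zero] at h
    exact h

/-- The operators `X J + J* X`, the velocities at `X` of the congruence action
`(g, X) ↦ g X g*`, fill the space of self-adjoint operators with vanishing compression to `ker X`. -/
lemma mem_selfAdjointZeroBlock_rangeProj_iff {X : H →L[ℂ] H} (hX : star X = X) {Z : H →L[ℂ] H} :
    Z ∈ selfAdjointZeroBlock (rangeProj X) ↔ ∃ J : H →L[ℂ] H, Z = X * J + star J * X := by
  rw [mem_selfAdjointZeroBlock]
  have hPX := rangeProj_mul X
  have hXP := mul_rangeProj hX
  have hPs := star_rangeProj X
  have hPP := rangeProj_mul_self X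
  have hu := isUnit_add_one_sub_rangeProj hX
  generalize rangeProj X = P at hPX hXP hPs hPP hu ⊢
  constructor
  · rintro ⟨h₁, h₂⟩
    set K := Ring.inverse (X + (1 - P)) with hK
    have hXK : X * K = P := by
      have h : P * (X + (1 - P)) = X := by
        rw [mul_add, hPX, mul_sub, hPP, mul_one, sub_self, add_zero]
      rw [← h, mul_assoc, Ring.mul_inverse_cancel _ hu, mul_one]
    have hKX : star K * X = P := by
      have := congrArg star hXK
      rwa [star_mul, hX, hPs] at this
    -- `Q Z Q = 0` reads `Z = P Z + Z P - P Z P = P G + G* P` with `G = Z - Z P / 2`, and `P = X K`.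
    refine ⟨K * (Z - (1 / 2 : ℝ) • (Z * P)), ?_⟩
    have e₁ : star (K * (Z - (1 / 2 : ℝ) • (Z * P))) = (Z - (1 / 2 : ℝ) • (P * Z)) * star K := by
      rw [star_mul, star_sub, star_smul, star_mul, h₁, hPs, star_trivial]
    have h₃ : Z - P * Z - Z * P + P * Z * P = 0 := by
      rw [← h₂]; noncomm_ring
    rw [e₁, ← mul_assoc, hXK, mul_assoc, hKX, mul_sub, sub_mul, mul_smul_comm, smul_mul_assoc,
      ← mul_assoc]
    have h₄ : (1 / 2 : ℝ) • (P * Z * P) + (1 / 2 : ℝ) • (P * Z * P) = P * Z * P := by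
      rw [← add_smul]; norm_num
    calc Z = P * Z + Z * P - P * Z * P := by
          rw [← sub_eq_zero, ← h₃]; abel
      _ = P * Z + Z * P - ((1 / 2 : ℝ) • (P * Z * P) + (1 / 2 : ℝ) • (P * Z * P)) := by rw [h₄]
      _ = _ := by abel
  · rintro ⟨J, rfl⟩
    refine ⟨by rw [star_add, star_mul, star_mul, star_star, hX, add_comm], ?_⟩
    have h₁ : (1 - P) * X = 0 := by rw [sub_mul, one_mul, hPX, sub_self]
    have h₂ : X * (1 - P) = 0 := by rw [mul_sub, mul_one, hXP, sub_self]
    rw [mul_add, add_mul, ← mul_assoc, h₁, zero_mul, zero_mul, mul_assoc, mul_assoc, h₂, mul_zero,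
      mul_zero, add_zero]

end FixedRank

/-! ### Signature and spectral decomposition -/

section Signature

variable {H : Type*} [NormedAddCommGroup H] [InnerProductSpace ℂ H] [FiniteDimensional ℂ H]

lemma star_eq_self_iff_isSymmetric {T : H →L[ℂ] H} :
    star T = T ↔ (T : H →ₗ[ℂ] H).IsSymmetric :=
  ContinuousLinearMap.isSelfAdjoint_iff_isSymmetric

/-- The rank of a self-adjoint operator is its number of nonzero eigenvalues. -/
lemma card_pos_add_card_neg_eigenvalues {T : H →ₗ[ℂ] H} (hT : T.IsSymmetric) :
    Nat.card {i // 0 < hT.eigenvalues rfl i} + Nat.card {i // hT.eigenvalues rfl i < 0} =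
      Module.finrank ℂ (LinearMap.range T) := by
  have h0 := hT.card_filter_eigenvalues_eq rfl (0 : ℂ)
  rw [Module.End.eigenspace_zero] at h0
  have h1 := T.finrank_range_add_finrank_ker
  have h2 : Finset.card {i | hT.eigenvalues rfl i = (0 : ℝ)} = Module.finrank ℂ (LinearMap.ker T) := by
    rw [← h0]; congr 1; ext i; simp
  have h3 := Finset.card_filter_add_card_filter_not (s := (Finset.univ : Finset (Fin _)))
    (fun i => hT.eigenvalues rfl i = 0)
  rw [Finset.card_univ, Fintype.card_fin, h2] at h3
  have h4 : Finset.card {i | ¬ hT.eigenvalues rfl i = 0} =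
      Finset.card {i | 0 < hT.eigenvalues rfl i} + Finset.card {i | hT.eigenvalues rfl i < 0} := by
    rw [← Finset.card_union_of_disjoint]
    · congr 1; ext i
      simp only [Finset.mem_filter, Finset.mem_univ, true_and, Finset.mem_union]
      rw [← ne_eq, ne_iff_lt_or_gt]; tauto
    · rw [Finset.disjoint_filter]
      intro i _ hi; exact not_lt.2 hi.le
  rw [Nat.card_eq_fintype_card, Nat.card_eq_fintype_card, Fintype.card_subtype,
    Fintype.card_subtype]
  omega

/-- The rank condition turns the two upper bounds on the numbers of eigenvalues into equalities. -/
lemma mem_signatureExact_iff {p q : ℕ} {T : H →L[ℂ] H} :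
    T ∈ signatureExact H p q ↔ ∃ hT : (T : H →ₗ[ℂ] H).IsSymmetric,
      Nat.card {i // 0 < hT.eigenvalues rfl i} = p ∧
        Nat.card {i // hT.eigenvalues rfl i < 0} = q := by
  constructor
  · rintro ⟨⟨hT, h₁, h₂⟩, h₃⟩
    have := card_pos_add_card_neg_eigenvalues hT
    exact ⟨hT, by omega, by omega⟩
  · rintro ⟨hT, h₁, h₂⟩
    have := card_pos_add_card_neg_eigenvalues hT
    exact ⟨⟨hT, h₁.le, h₂.le⟩, by omega⟩

lemma eq_sum_eigenvalues_smul_rankOne {T : H →L[ℂ] H} (hT : (T : H →ₗ[ℂ] H).IsSymmetric) :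
    T = ∑ i, (hT.eigenvalues rfl i : ℂ) •
      InnerProductSpace.rankOne ℂ (hT.eigenvectorBasis rfl i) (hT.eigenvectorBasis rfl i) := by
  ext z
  have hT' : ∀ i, T (hT.eigenvectorBasis rfl i) =
      (hT.eigenvalues rfl i : ℂ) • hT.eigenvectorBasis rfl i := hT.apply_eigenvectorBasis rfl
  conv_lhs => rw [← (hT.eigenvectorBasis rfl).sum_repr' z]
  simp only [map_sum, map_smul, hT', sum_apply, smul_apply,
    InnerProductSpace.rankOne_apply]
  exact Finset.sum_congr rfl fun i _ => smul_comm _ _ _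

lemma re_inner_apply_eq_sum {T : H →L[ℂ] H} (hT : (T : H →ₗ[ℂ] H).IsSymmetric) (v : H) :
    (inner ℂ v (T v)).re =
      ∑ i, hT.eigenvalues rfl i * ‖inner ℂ (hT.eigenvectorBasis rfl i) v‖ ^ 2 := by
  conv_lhs => rw [eq_sum_eigenvalues_smul_rankOne hT]
  simp only [sum_apply, smul_apply, InnerProductSpace.rankOne_apply, inner_sum,
    inner_smul_right, Complex.re_sum, Complex.re_ofReal_mul]
  refine Finset.sum_congr rfl fun i _ => ?_
  rw [← inner_conj_symm, mul_comm, Complex.conj_mul', ← Complex.ofReal_pow, Complex.ofReal_re,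
    RCLike.norm_conj, norm_inner_symm, mul_comm]

/-- A self-adjoint operator has a positive eigenvalue exactly when its quadratic form takes a
positive value. -/
lemma exists_pos_eigenvalue_iff {T : H →L[ℂ] H} (hT : (T : H →ₗ[ℂ] H).IsSymmetric) :
    (∃ i, 0 < hT.eigenvalues rfl i) ↔ ∃ v, 0 < (inner ℂ v (T v)).re := by
  constructor
  · rintro ⟨i, hi⟩
    refine ⟨hT.eigenvectorBasis rfl i, ?_⟩
    have h : T (hT.eigenvectorBasis rfl i) = (hT.eigenvalues rfl i : ℂ) • hT.eigenvectorBasis rfl i :=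
      hT.apply_eigenvectorBasis rfl i
    simpa [h, inner_smul_right] using hi
  · rintro ⟨v, hv⟩
    by_contra! h
    rw [re_inner_apply_eq_sum hT] at hv
    exact hv.not_ge (Finset.sum_nonpos fun i _ => mul_nonpos_of_nonpos_of_nonneg (h i) (sq_nonneg _))

lemma exists_neg_eigenvalue_iff {T : H →L[ℂ] H} (hT : (T : H →ₗ[ℂ] H).IsSymmetric) :
    (∃ i, hT.eigenvalues rfl i < 0) ↔ ∃ v, (inner ℂ v (T v)).re < 0 := by
  constructor
  · rintro ⟨i, hi⟩
    refine ⟨hT.eigenvectorBasis rfl i, ?_⟩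
    have h : T (hT.eigenvectorBasis rfl i) = (hT.eigenvalues rfl i : ℂ) • hT.eigenvectorBasis rfl i :=
      hT.apply_eigenvectorBasis rfl i
    simpa [h, inner_smul_right] using hi
  · rintro ⟨v, hv⟩
    by_contra! h
    rw [re_inner_apply_eq_sum hT] at hv
    exact hv.not_ge (Finset.sum_nonneg fun i _ => mul_nonneg (h i) (sq_nonneg _))

variable (H) in
lemma isOpen_exists_re_inner_pos : IsOpen {T : H →L[ℂ] H | ∃ v, 0 < (inner ℂ v (T v)).re} := by
  simp only [Set.ofPred_exists]
  exact isOpen_iUnion fun v => isOpen_lt continuous_const (by fun_prop)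

variable (H) in
lemma isOpen_exists_re_inner_neg : IsOpen {T : H →L[ℂ] H | ∃ v, (inner ℂ v (T v)).re < 0} := by
  simp only [Set.ofPred_exists]
  exact isOpen_iUnion fun v => isOpen_lt (by fun_prop) continuous_const

lemma card_subtype_pos_iff {ι : Type*} [Finite ι] {P : ι → Prop} :
    0 < Nat.card {i // P i} ↔ ∃ i, P i := by
  rw [Nat.card_pos_iff, nonempty_subtype, and_iff_left Subtype.finite]

lemma mem_signatureExact_one_zero_iff {T : H →L[ℂ] H} :
    T ∈ signatureExact H 1 0 ↔ star T = T ∧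
      Module.finrank ℂ (LinearMap.range (T : H →ₗ[ℂ] H)) = 1 ∧
      T ∈ {T : H →L[ℂ] H | ∃ v, 0 < (inner ℂ v (T v)).re} := by
  rw [mem_signatureExact_iff, star_eq_self_iff_isSymmetric, ← exists_prop]
  refine exists_congr fun hT => ?_
  rw [Set.mem_ofPred_eq, ← exists_pos_eigenvalue_iff hT, ← card_subtype_pos_iff,
    ← card_pos_add_card_neg_eigenvalues hT]
  omega

lemma mem_signatureExact_one_one_iff {T : H →L[ℂ] H} :
    T ∈ signatureExact H 1 1 ↔ star T = T ∧
      Module.finrank ℂ (LinearMap.range (T : H →ₗ[ℂ] H)) = 2 ∧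
      T ∈ {T : H →L[ℂ] H | ∃ v, 0 < (inner ℂ v (T v)).re} ∩
        {T : H →L[ℂ] H | ∃ v, (inner ℂ v (T v)).re < 0} := by
  rw [mem_signatureExact_iff, star_eq_self_iff_isSymmetric, ← exists_prop]
  refine exists_congr fun hT => ?_
  rw [Set.mem_inter_iff, Set.mem_ofPred_eq, Set.mem_ofPred_eq, ← exists_pos_eigenvalue_iff hT,
    ← exists_neg_eigenvalue_iff hT, ← card_subtype_pos_iff, ← card_subtype_pos_iff,
    ← card_pos_add_card_neg_eigenvalues hT]
  omega

lemma exists_eq_rankOne_of_mem_signatureExact {X : H →L[ℂ] H} (hX : X ∈ signatureExact H 1 0) :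
    ∃ x₀ : H, X = InnerProductSpace.rankOne ℂ x₀ x₀ := by
  obtain ⟨hT, hp, hq⟩ := mem_signatureExact_iff.1 hX
  obtain ⟨hsub, ⟨i, hi⟩⟩ := Nat.card_eq_one_iff_unique.1 hp
  have hrest : ∀ k, k ≠ i → hT.eigenvalues rfl k = 0 := by
    intro k hk
    by_contra h
    rcases lt_or_gt_of_ne h with h | h
    · exact (card_subtype_pos_iff.2 ⟨k, h⟩).ne' hq
    · exact hk (congrArg Subtype.val
        (Subsingleton.elim (⟨k, h⟩ : {i // 0 < hT.eigenvalues rfl i}) ⟨i, hi⟩))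
  have hs := eq_sum_eigenvalues_smul_rankOne hT
  rw [Finset.sum_eq_single i (fun k _ hk => by simp [hrest k hk]) (by simp)] at hs
  refine ⟨((√(hT.eigenvalues rfl i) : ℝ) : ℂ) • hT.eigenvectorBasis rfl i, hs.trans ?_⟩
  ext z
  simp only [smul_apply, InnerProductSpace.rankOne_apply, inner_smul_left, Complex.conj_ofReal,
    smul_smul]
  congr 1
  rw [mul_right_comm, ← Complex.ofReal_mul, Real.mul_self_sqrt hi.le]

/-- With `λ e e* - μ f f*` the spectral decomposition, the vectors are `√λ e ± √μ f`. -/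
lemma exists_eq_symOuter_of_mem_signatureExact {X : H →L[ℂ] H} (hX : X ∈ signatureExact H 1 1) :
    ∃ x₀ y₀ : H, X = symOuter x₀ y₀ := by
  obtain ⟨hT, hp, hq⟩ := mem_signatureExact_iff.1 hX
  obtain ⟨hsub, ⟨i, hi⟩⟩ := Nat.card_eq_one_iff_unique.1 hp
  obtain ⟨hsub', ⟨j, hj⟩⟩ := Nat.card_eq_one_iff_unique.1 hq
  have hij : i ≠ j := fun h => (hi.trans (h ▸ hj)).false
  have hrest : ∀ k, k ≠ i ∧ k ≠ j → hT.eigenvalues rfl k = 0 := by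
    rintro k ⟨hki, hkj⟩
    by_contra h
    rcases lt_or_gt_of_ne h with h | h
    · exact hkj (congrArg Subtype.val
        (Subsingleton.elim (⟨k, h⟩ : {i // hT.eigenvalues rfl i < 0}) ⟨j, hj⟩))
    · exact hki (congrArg Subtype.val
        (Subsingleton.elim (⟨k, h⟩ : {i // 0 < hT.eigenvalues rfl i}) ⟨i, hi⟩))
  have hs := eq_sum_eigenvalues_smul_rankOne hT
  rw [Finset.sum_eq_add i j hij (fun k _ hk => by simp [hrest k hk]) (by simp) (by simp)] at hs
  have hl : ((√(hT.eigenvalues rfl i) : ℝ) : ℂ) * (√(hT.eigenvalues rfl i) : ℝ) =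
      hT.eigenvalues rfl i := by
    rw [← Complex.ofReal_mul, Real.mul_self_sqrt hi.le]
  have hm : ((√(-hT.eigenvalues rfl j) : ℝ) : ℂ) * (√(-hT.eigenvalues rfl j) : ℝ) =
      -hT.eigenvalues rfl j := by
    rw [← Complex.ofReal_mul, Real.mul_self_sqrt (by linarith), Complex.ofReal_neg]
  set l : ℂ := ((√(hT.eigenvalues rfl i) : ℝ) : ℂ) with hldef
  set m : ℂ := ((√(-hT.eigenvalues rfl j) : ℝ) : ℂ) with hmdef
  have hlc : (starRingEnd ℂ) l = l := Complex.conj_ofReal _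
  have hmc : (starRingEnd ℂ) m = m := Complex.conj_ofReal _
  set e := hT.eigenvectorBasis rfl i
  set f := hT.eigenvectorBasis rfl j
  refine ⟨l • e + m • f, l • e - m • f, hs.trans ?_⟩
  have hm' : (hT.eigenvalues rfl j : ℂ) = -(m * m) := by rw [hm, neg_neg]
  rw [← hl, hm']
  ext z
  simp only [symOuter, smul_apply, add_apply, InnerProductSpace.rankOne_apply, inner_add_left,
    inner_sub_left, inner_smul_left, hlc, hmc]
  rw [← Complex.coe_smul]
  push_cast
  module

end Signature

/-! ### Tangent spaces as ranges -/

section TangentSpaces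

variable {H : Type*} [NormedAddCommGroup H] [InnerProductSpace ℂ H]

lemma symOuter_apply (u v z : H) :
    symOuter u v z = (1 / 2 : ℂ) • (inner ℂ v z • u + inner ℂ u z • v) := by
  simp only [symOuter, smul_apply, add_apply, InnerProductSpace.rankOne_apply]
  rw [← Complex.coe_smul]
  push_cast
  rfl

lemma symOuter_self (x : H) : symOuter x x = InnerProductSpace.rankOne ℂ x x := by
  ext z
  rw [symOuter_apply, InnerProductSpace.rankOne_apply]
  module

/-- The component of `x` orthogonal to `y`, rescaled, is dual to the pair `(x, y)`. -/
lemma exists_inner_eq_one_and_inner_eq_zero {x y : H} (h : x ∉ Submodule.span ℂ {y}) :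
    ∃ w : H, inner ℂ w x = 1 ∧ inner ℂ w y = 0 := by
  set K := Submodule.span ℂ {y}
  set w := x - K.starProjection x with hw
  have hwK : w ∈ Kᗮ := K.sub_starProjection_mem_orthogonal x
  have hw0 : w ≠ 0 := fun h0 => h (by
    rw [← Submodule.starProjection_eq_self_iff]; exact (sub_eq_zero.1 h0).symm)
  have hwx : inner ℂ w x = inner ℂ w w := by
    rw [hw, inner_sub_right, ← hw, Submodule.inner_left_of_mem_orthogonal
      (Submodule.starProjection_apply_mem K x) hwK, sub_zero]
  have hww : inner ℂ w w ≠ 0 := inner_self_ne_zero.2 hw0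
  have hwy : inner ℂ w y = 0 :=
    Submodule.inner_left_of_mem_orthogonal (Submodule.mem_span_singleton_self y) hwK
  refine ⟨((starRingEnd ℂ) (inner ℂ w w)⁻¹) • w, ?_, ?_⟩
  · rw [inner_smul_left, Complex.conj_conj, hwx, inv_mul_cancel₀ hww]
  · rw [inner_smul_left, hwy, mul_zero]

lemma range_symOuter_le (x y : H) :
    LinearMap.range (symOuter x y : H →ₗ[ℂ] H) ≤ Submodule.span ℂ {x, y} := by
  rintro _ ⟨z, rfl⟩
  change symOuter x y z ∈ _
  rw [symOuter_apply]
  have hx : x ∈ Submodule.span ℂ {x, y} := Submodule.subset_span (by simp)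
  have hy : y ∈ Submodule.span ℂ {x, y} := Submodule.subset_span (by simp)
  exact Submodule.smul_mem _ _ (add_mem (Submodule.smul_mem _ _ hx) (Submodule.smul_mem _ _ hy))

lemma finrank_span_singleton_le (y : H) : Module.finrank ℂ (Submodule.span ℂ {y}) ≤ 1 := by
  simpa using finrank_span_le_card (R := ℂ) ({y} : Set H)

lemma finrank_span_pair_le (x y : H) : Module.finrank ℂ (Submodule.span ℂ {x, y}) ≤ 2 := by
  classical
  refine (finrank_span_le_card (R := ℂ) ({x, y} : Set H)).trans ?_
  rw [Set.toFinset_insert, Set.toFinset_singleton]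
  exact Finset.card_le_two

section FiniteDimensional

variable [FiniteDimensional ℂ H]

lemma star_symOuter (u v : H) : star (symOuter u v) = symOuter u v := by
  rw [ContinuousLinearMap.star_eq_adjoint, eq_comm, ContinuousLinearMap.eq_adjoint_iff]
  intro x y
  rw [symOuter_apply, symOuter_apply, inner_smul_left, inner_smul_right, inner_add_left,
    inner_add_right]
  simp only [inner_smul_left, inner_smul_right, inner_conj_symm]
  rw [map_div₀, map_one, map_ofNat]
  ring

/-- Congruence velocities at `[x, y]` are again sums of symmetric outer products. -/
lemma symOuter_mul_add_star_mul_symOuter (x y : H) (J : H →L[ℂ] H) :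
    symOuter x y * J + star J * symOuter x y =
      symOuter x (star J y) + symOuter y (star J x) := by
  ext z
  have h : ∀ w, inner ℂ w (J z) = inner ℂ (star J w) z := fun w =>
    (ContinuousLinearMap.adjoint_inner_left J z w).symm
  change symOuter x y (J z) + star J (symOuter x y z) =
    symOuter x (star J y) z + symOuter y (star J x) z
  simp only [symOuter_apply, h, map_smul, map_add]
  module

lemma symOuter_mem_selfAdjointZeroBlock {X : H →L[ℂ] H} {x : H}
    (hx : x ∈ LinearMap.range (X : H →ₗ[ℂ] H)) (y : H) :
    symOuter x y ∈ selfAdjointZeroBlock (rangeProj X) := by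
  refine ⟨star_symOuter x y, ?_⟩
  have hPx : rangeProj X x = x := Submodule.starProjection_eq_self_iff.2 hx
  have hQ : star (1 - rangeProj X) = 1 - rangeProj X := by
    rw [star_sub, star_one, star_rangeProj]
  ext z
  have hQx : (1 - rangeProj X) x = 0 := by
    change x - rangeProj X x = 0
    rw [hPx, sub_self]
  have hin : inner ℂ x ((1 - rangeProj X) z) = 0 := by
    rw [← ContinuousLinearMap.adjoint_inner_left, ← ContinuousLinearMap.star_eq_adjoint, hQ, hQx,
      inner_zero_left]
  change (1 - rangeProj X) (symOuter x y ((1 - rangeProj X) z)) = 0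
  rw [symOuter_apply, hin, zero_smul, add_zero, map_smul, map_smul, hQx, smul_zero, smul_zero]

variable {x₀ y₀ : H}

lemma ne_zero_of_rankOne_mem_signatureExact
    (hX : InnerProductSpace.rankOne ℂ x₀ x₀ ∈ signatureExact H 1 0) : x₀ ≠ 0 := by
  rintro rfl
  have h := hX.2
  have h0 : InnerProductSpace.rankOne ℂ (0 : H) (0 : H) = 0 := by ext; simp
  rw [h0, ContinuousLinearMap.toLinearMap_zero, LinearMap.range_zero, finrank_bot] at h
  omega

lemma notMem_span_of_symOuter_mem_signatureExact
    (hX : symOuter x₀ y₀ ∈ signatureExact H 1 1) :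
    x₀ ∉ Submodule.span ℂ {y₀} ∧ y₀ ∉ Submodule.span ℂ {x₀} := by
  have hle := Submodule.finrank_mono (range_symOuter_le x₀ y₀)
  rw [hX.2] at hle
  constructor <;> intro h
  · rw [Submodule.span_insert_eq_span h] at hle
    have := finrank_span_singleton_le y₀
    omega
  · rw [Set.pair_comm, Submodule.span_insert_eq_span h] at hle
    have := finrank_span_singleton_le x₀
    omega

lemma selfAdjointZeroBlock_eq_range_phiOne
    (hX : InnerProductSpace.rankOne ℂ x₀ x₀ ∈ signatureExact H 1 0) :
    selfAdjointZeroBlock (rangeProj (InnerProductSpace.rankOne ℂ x₀ x₀)) =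
      LinearMap.range (phiOne x₀) := by
  rw [← symOuter_self] at hX ⊢
  have hx : x₀ ∈ LinearMap.range (symOuter x₀ x₀ : H →ₗ[ℂ] H) := by
    have hle := range_symOuter_le x₀ x₀
    rw [Set.pair_eq_singleton] at hle
    rw [Submodule.eq_of_le_of_finrank_le hle
      (by rw [hX.2]; exact finrank_span_singleton_le x₀)]
    exact Submodule.mem_span_singleton_self x₀
  ext Z
  constructor
  · rw [mem_selfAdjointZeroBlock_rangeProj_iff (star_symOuter _ _)]
    rintro ⟨J, rfl⟩
    refine ⟨star J x₀ + star J x₀, ?_⟩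
    rw [symOuter_mul_add_star_mul_symOuter]
    exact symOuter_add_right _ _ _
  · rintro ⟨y, rfl⟩
    exact symOuter_mem_selfAdjointZeroBlock hx y

lemma selfAdjointZeroBlock_eq_range_phiTwo (hX : symOuter x₀ y₀ ∈ signatureExact H 1 1) :
    selfAdjointZeroBlock (rangeProj (symOuter x₀ y₀)) = LinearMap.range (phiTwo x₀ y₀) := by
  have hr := Submodule.eq_of_le_of_finrank_le (range_symOuter_le x₀ y₀)
    (by rw [hX.2]; exact finrank_span_pair_le x₀ y₀)
  have hx : x₀ ∈ LinearMap.range (symOuter x₀ y₀ : H →ₗ[ℂ] H) := by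
    rw [hr]; exact Submodule.subset_span (by simp)
  have hy : y₀ ∈ LinearMap.range (symOuter x₀ y₀ : H →ₗ[ℂ] H) := by
    rw [hr]; exact Submodule.subset_span (by simp)
  ext Z
  constructor
  · rw [mem_selfAdjointZeroBlock_rangeProj_iff (star_symOuter _ _)]
    rintro ⟨J, rfl⟩
    rw [symOuter_mul_add_star_mul_symOuter]
    exact ⟨(star J y₀, star J x₀), rfl⟩
  · rintro ⟨⟨u, v⟩, rfl⟩
    exact add_mem (symOuter_mem_selfAdjointZeroBlock hx u) (symOuter_mem_selfAdjointZeroBlock hy v)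

end FiniteDimensional

/-! ### Kernels and dimensions -/

variable {x₀ y₀ : H}

lemma mem_ker_phiTwo_iff {u v : H} : (u, v) ∈ LinearMap.ker (phiTwo x₀ y₀) ↔
    ∀ z, inner ℂ u z • x₀ + inner ℂ x₀ z • u + (inner ℂ v z • y₀ + inner ℂ y₀ z • v) = 0 := by
  rw [LinearMap.mem_ker, ContinuousLinearMap.ext_iff]
  refine forall_congr' fun z => ?_
  change symOuter x₀ u z + symOuter y₀ v z = 0 ↔ _
  rw [symOuter_apply, symOuter_apply, ← smul_add, smul_eq_zero_iff_right (by norm_num)]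

lemma ker_phiOne (hx : x₀ ≠ 0) :
    (LinearMap.ker (phiOne x₀) : Set H) = {y | ∃ a : ℝ, y = a • (Complex.I • x₀)} := by
  ext y
  rw [SetLike.mem_coe, LinearMap.mem_ker]
  constructor
  · intro h
    obtain ⟨w, hw, -⟩ := exists_inner_eq_one_and_inner_eq_zero (x := x₀) (y := 0) (by simpa using hx)
    have hw' : inner ℂ x₀ w = 1 := by rw [← inner_conj_symm, hw, map_one]
    have h₁ : symOuter x₀ y w = 0 := by
      change phiOne x₀ y w = 0
      rw [h]; rfl
    rw [symOuter_apply, smul_eq_zero_iff_right (by norm_num), hw', one_smul] at h₁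
    set α := inner ℂ y w with hα
    have hy : y = -(α • x₀) := (neg_eq_of_add_eq_zero_right h₁).symm
    have hα' : α = -(starRingEnd ℂ) α := by
      conv_lhs => rw [hα, hy, inner_neg_left, inner_smul_left, hw', mul_one]
    refine ⟨-α.im, ?_⟩
    have hre : α.re = 0 := by
      have := congrArg Complex.re hα'
      simp at this; linarith
    have hα'' : α = α.im * Complex.I := by
      apply Complex.ext <;> simp [hre]
    conv_lhs => rw [hy, hα'']
    rw [← Complex.coe_smul]
    push_cast
    module
  · rintro ⟨a, rfl⟩
    ext z
    change symOuter x₀ _ z = 0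
    rw [symOuter_apply, ← Complex.coe_smul, inner_smul_left, inner_smul_left, Complex.conj_ofReal,
      Complex.conj_I]
    module

/-- The four generators of the kernel of `(u, v) ↦ [x₀, u] + [y₀, v]`. -/
def kerGenerators (x₀ y₀ : H) : Fin 4 → H × H :=
  ![(Complex.I • x₀, 0), (0, Complex.I • y₀), (y₀, -x₀), (Complex.I • y₀, Complex.I • x₀)]

lemma ker_phiTwo (hx : x₀ ∉ Submodule.span ℂ {y₀}) (hy : y₀ ∉ Submodule.span ℂ {x₀}) :
    (LinearMap.ker (phiTwo x₀ y₀) : Set (H × H)) =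
      {w | ∃ a b c d : ℝ, w = a • (Complex.I • x₀, 0) + b • (0, Complex.I • y₀) +
        c • (y₀, -x₀) + d • (Complex.I • y₀, Complex.I • x₀)} := by
  ext ⟨u, v⟩
  rw [SetLike.mem_coe, mem_ker_phiTwo_iff]
  simp only [Set.mem_ofPred_eq, Prod.ext_iff, Prod.fst_add, Prod.snd_add, Prod.smul_fst,
    Prod.smul_snd, smul_zero, add_zero, zero_add, ← Complex.coe_smul]
  constructor
  · intro h
    obtain ⟨a, hax, hay⟩ := exists_inner_eq_one_and_inner_eq_zero hx
    obtain ⟨b, hby, hbx⟩ := exists_inner_eq_one_and_inner_eq_zero hy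
    replace hax : inner ℂ x₀ a = 1 := by rw [← inner_conj_symm, hax, map_one]
    replace hay : inner ℂ y₀ a = 0 := by rw [← inner_conj_symm, hay, map_zero]
    replace hbx : inner ℂ x₀ b = 0 := by rw [← inner_conj_symm, hbx, map_zero]
    replace hby : inner ℂ y₀ b = 1 := by rw [← inner_conj_symm, hby, map_one]
    -- Evaluation at the dual vectors expresses `u` and `v` through `x₀` and `y₀`; pairing these
    -- expressions with `a` and `b` again gives the relations between the coefficients.
    have ha := h a
    have hb := h b
    rw [hax, hay, one_smul, zero_smul, add_zero] at ha
    rw [hbx, hby, one_smul, zero_smul, add_zero] at hb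
    set α := inner ℂ u a with hα
    set β := inner ℂ v a with hβ
    set γ := inner ℂ u b with hγ
    set δ := inner ℂ v b with hδ
    have hu : u = -(α • x₀ + β • y₀) := by
      rw [← sub_eq_zero, ← ha]; abel
    have hv : v = -(γ • x₀ + δ • y₀) := by
      rw [← sub_eq_zero, ← hb]; abel
    have hα' : α = -(starRingEnd ℂ) α := by
      conv_lhs => rw [hα, hu, inner_neg_left, inner_add_left, inner_smul_left, inner_smul_left, hax,
        hay, mul_one, mul_zero, add_zero]
    have hγ' : γ = -(starRingEnd ℂ) β := by
      conv_lhs => rw [hγ, hu, inner_neg_left, inner_add_left, inner_smul_left, inner_smul_left, hbx,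
        hby, mul_one, mul_zero, zero_add]
    have hδ' : δ = -(starRingEnd ℂ) δ := by
      conv_lhs => rw [hδ, hv, inner_neg_left, inner_add_left, inner_smul_left, inner_smul_left, hbx,
        hby, mul_one, mul_zero, zero_add]
    have hαre : α.re = 0 := by
      have := congrArg Complex.re hα'
      simp at this; linarith
    have hδre : δ.re = 0 := by
      have := congrArg Complex.re hδ'
      simp at this; linarith
    have hα'' : α = α.im * Complex.I := by apply Complex.ext <;> simp [hαre]
    have hδ'' : δ = δ.im * Complex.I := by apply Complex.ext <;> simp [hδre]
    have hβ'' : β = β.re + β.im * Complex.I := (Complex.re_add_im β).symm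
    have hγ'' : γ = -(β.re - β.im * Complex.I) := by
      rw [hγ']; apply Complex.ext <;> simp
    refine ⟨-α.im, -δ.im, -β.re, -β.im, ?_, ?_⟩
    · conv_lhs => rw [hu, hα'', hβ'']
      push_cast
      module
    · conv_lhs => rw [hv, hγ'', hδ'']
      push_cast
      module
  · rintro ⟨a, b, c, d, rfl, rfl⟩ z
    simp only [inner_add_left, inner_smul_left, inner_neg_left, Complex.conj_ofReal, Complex.conj_I]
    module

lemma linearIndependent_kerGenerators (hx : x₀ ∉ Submodule.span ℂ {y₀})
    (hy : y₀ ∉ Submodule.span ℂ {x₀}) : LinearIndependent ℝ (kerGenerators x₀ y₀) := by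
  obtain ⟨a, hax, hay⟩ := exists_inner_eq_one_and_inner_eq_zero hx
  obtain ⟨b, hby, hbx⟩ := exists_inner_eq_one_and_inner_eq_zero hy
  rw [Fintype.linearIndependent_iff]
  intro g hg
  simp only [kerGenerators, Fin.sum_univ_four, Matrix.cons_val, Prod.ext_iff, Prod.fst_add,
    Prod.snd_add, Prod.smul_fst, Prod.smul_snd, smul_zero, add_zero, zero_add,
    ← Complex.coe_smul, Prod.fst_zero, Prod.snd_zero] at hg
  have h₁ := congrArg (inner ℂ a) hg.1
  have h₂ := congrArg (inner ℂ b) hg.1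
  have h₃ := congrArg (inner ℂ b) hg.2
  simp only [inner_add_right, inner_smul_right, hax, hay, hbx, hby, inner_zero_right, mul_zero,
    mul_one, add_zero, zero_add, inner_neg_right, neg_zero] at h₁ h₂ h₃
  have e₀ := congrArg Complex.im h₁
  have e₁ := congrArg Complex.im h₃
  have e₂ := congrArg Complex.re h₂
  have e₃ := congrArg Complex.im h₂
  simp at e₀ e₁ e₂ e₃
  intro i
  fin_cases i <;> assumption

variable [FiniteDimensional ℂ H]

lemma finrank_range_phiOne (hx : x₀ ≠ 0) :
    Module.finrank ℝ (LinearMap.range (phiOne x₀)) = 2 * Module.finrank ℂ H - 1 := by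
  have hk : LinearMap.ker (phiOne x₀) = Submodule.span ℝ {Complex.I • x₀} := by
    apply SetLike.coe_injective
    rw [ker_phiOne hx]
    ext y
    simp only [Set.mem_ofPred_eq, SetLike.mem_coe, Submodule.mem_span_singleton, eq_comm]
  have h := (phiOne x₀).finrank_range_add_finrank_ker
  rw [hk, finrank_span_singleton (smul_ne_zero Complex.I_ne_zero hx),
    finrank_real_of_complex] at h
  omega

lemma finrank_range_phiTwo (hx : x₀ ∉ Submodule.span ℂ {y₀}) (hy : y₀ ∉ Submodule.span ℂ {x₀}) :
    Module.finrank ℝ (LinearMap.range (phiTwo x₀ y₀)) = 4 * Module.finrank ℂ H - 4 := by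
  have hk : LinearMap.ker (phiTwo x₀ y₀) = Submodule.span ℝ (Set.range (kerGenerators x₀ y₀)) := by
    apply SetLike.coe_injective
    rw [ker_phiTwo hx hy]
    ext w
    rw [SetLike.mem_coe, Submodule.mem_span_range_iff_exists_fun]
    constructor
    · rintro ⟨a, b, c, d, rfl⟩
      exact ⟨![a, b, c, d], by simp [kerGenerators, Fin.sum_univ_four]⟩
    · rintro ⟨g, rfl⟩
      exact ⟨g 0, g 1, g 2, g 3, by simp [kerGenerators, Fin.sum_univ_four]⟩
  have h := (phiTwo x₀ y₀).finrank_range_add_finrank_ker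
  rw [hk, finrank_span_eq_card (linearIndependent_kerGenerators hx hy), Fintype.card_fin,
    Module.finrank_prod, finrank_real_of_complex] at h
  omega

end TangentSpaces

end

theorem lemma3p2p3 {H : Type*} [NormedAddCommGroup H] [InnerProductSpace ℂ H]
    [FiniteDimensional ℂ H] (n : ℕ) (hn : Module.finrank ℂ H = n) :
    -- signature (1, 0); if `n = 0` the set is empty, and the truncated dimension is immaterial
    ((∃ _ : ChartedSpace (EuclideanSpace ℝ (Fin (2 * n - 1))) (signatureExact H 1 0),
        IsAnalyticSubmanifold (2 * n - 1) (signatureExact H 1 0) ∧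
        ∀ (x₀ : H) (hX : InnerProductSpace.rankOne ℂ x₀ x₀ ∈ signatureExact H 1 0),
          (tangentSpaceIn (2 * n - 1) (signatureExact H 1 0) ⟨_, hX⟩ : Set (H →L[ℂ] H)) =
            {T | ∃ y : H, T = symOuter x₀ y}) ∧
      (∀ X ∈ signatureExact H 1 0, ∃ x₀ : H, X = InnerProductSpace.rankOne ℂ x₀ x₀) ∧
      ∀ x₀ : H, InnerProductSpace.rankOne ℂ x₀ x₀ ∈ signatureExact H 1 0 →
        (LinearMap.ker (phiOne x₀) : Set H) = {y | ∃ a : ℝ, y = a • (Complex.I • x₀)}) ∧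
    -- signature (1, 1); if `n ≤ 1` the set is empty
    ((∃ _ : ChartedSpace (EuclideanSpace ℝ (Fin (4 * n - 4))) (signatureExact H 1 1),
        IsAnalyticSubmanifold (4 * n - 4) (signatureExact H 1 1) ∧
        ∀ (x₀ y₀ : H) (hX : symOuter x₀ y₀ ∈ signatureExact H 1 1),
          (tangentSpaceIn (4 * n - 4) (signatureExact H 1 1) ⟨_, hX⟩ : Set (H →L[ℂ] H)) =
            {T | ∃ u v : H, T = symOuter x₀ u + symOuter y₀ v}) ∧
      (∀ X ∈ signatureExact H 1 1, ∃ x₀ y₀ : H, X = symOuter x₀ y₀) ∧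
      ∀ x₀ y₀ : H, symOuter x₀ y₀ ∈ signatureExact H 1 1 →
        (LinearMap.ker (phiTwo x₀ y₀) : Set (H × H)) =
          {w | ∃ a b c d : ℝ, w = a • (Complex.I • x₀, 0) + b • (0, Complex.I • y₀) +
            c • (y₀, -x₀) + d • (Complex.I • y₀, Complex.I • x₀)}) := by
  subst hn
  refine ⟨⟨?_, fun X hX => exists_eq_rankOne_of_mem_signatureExact hX,
    fun x₀ hX => ker_phiOne (ne_zero_of_rankOne_mem_signatureExact hX)⟩,
    ⟨?_, fun X hX => exists_eq_symOuter_of_mem_signatureExact hX, fun x₀ y₀ hX =>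
      ker_phiTwo (notMem_span_of_symOuter_mem_signatureExact hX).1
        (notMem_span_of_symOuter_mem_signatureExact hX).2⟩⟩
  · obtain ⟨i, hi, ht⟩ := exists_isAnalyticSubmanifold (S := signatureExact H 1 0)
      (d := 2 * Module.finrank ℂ H - 1) (fun X => selfAdjointZeroBlock (rangeProj X))
      (fun X hX => by
        obtain ⟨x₀, rfl⟩ := exists_eq_rankOne_of_mem_signatureExact hX
        rw [selfAdjointZeroBlock_eq_range_phiOne hX,
          finrank_range_phiOne (ne_zero_of_rankOne_mem_signatureExact hX)])
      (fun X hX => exists_schurChart_straightening (isOpen_exists_re_inner_pos H)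
        (fun T => mem_signatureExact_one_zero_iff) hX)
    refine ⟨i, hi, fun x₀ hX => ?_⟩
    rw [ht, selfAdjointZeroBlock_eq_range_phiOne hX]
    ext T
    exact exists_congr fun y => eq_comm
  · obtain ⟨i, hi, ht⟩ := exists_isAnalyticSubmanifold (S := signatureExact H 1 1)
      (d := 4 * Module.finrank ℂ H - 4) (fun X => selfAdjointZeroBlock (rangeProj X))
      (fun X hX => by
        obtain ⟨x₀, y₀, rfl⟩ := exists_eq_symOuter_of_mem_signatureExact hX
        have h := notMem_span_of_symOuter_mem_signatureExact hX
        rw [selfAdjointZeroBlock_eq_range_phiTwo hX, finrank_range_phiTwo h.1 h.2])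
      (fun X hX => exists_schurChart_straightening
        ((isOpen_exists_re_inner_pos H).inter (isOpen_exists_re_inner_neg H))
        (fun T => mem_signatureExact_one_one_iff) hX)
    refine ⟨i, hi, fun x₀ y₀ hX => ?_⟩
    rw [ht, selfAdjointZeroBlock_eq_range_phiTwo hX]
    ext T
    constructor
    · rintro ⟨⟨u, v⟩, rfl⟩
      exact ⟨u, v, rfl⟩
    · rintro ⟨u, v, rfl⟩
      exact ⟨(u, v), rfl⟩
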